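/- All spaces are topological spaces. A P-space is a space in which every intersection of countably many open sets is open. For a space $X$ and an ordinal $\alpha$, $X^{\alpha}$ denotes the $\alpha$-th Cantor–Bendixson derivative of $X$; $X$ is scattered if $X^{\alpha}=\emptyset$ for some $\alpha$. For scattered $X$, the height $\mathrm{ht}(X)$ is the least $\alpha$ with $X^{\alpha}=\emptyset$, the levels are $I_\alpha(X)=X^{\alpha}\setminus X^{\alpha+1}$ for $\alpha<\mathrm{ht}(X)$, the level $\rho(x)$ of a point $x$ is the unique $\alpha$ with $x\in I_\alpha(X)$, and the width of $X$ is $\sup\{|I_\alpha(X)|:\alpha<\mathrm{ht}(X)\}$. A cone on $x\in X$ is a neighbourhood $U$ of $x$ such that $x$ is the only point of $U$ of level $\geq\rho(x)$. An LLSP space is a locally Lindelöf (every point has a Lindelöf neighbourhood), scattered, Hausdorff P-space. For an uncountable cardinal $\kappa$ and an ordinal $\alpha\ne0$, a $(\kappa,\alpha)$-LLSP space is an LLSP space of width $\kappa$ and height $\alpha$. An LLSP space $X$ is good if for every $\alpha<\mathrm{ht}(X)$ and every family $\{U_n:n\in\omega\}$ of Lindelöf clopen cones on points of $X$, the set $I_\alpha(X)\setminus\bigcup_{n\in\omega}U_n$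 is uncountable. For $x\in I_{\beta+1}(X)$ with $\beta+1<\mathrm{ht}(X)$, a neighbourhood basis $\mathbb B_x$ of $x$ is the admissible basis for $x$ given by $\{U_\nu:\nu<\omega_1\}$ if the sets $U_\nu$ are pairwise disjoint, each $U_\nu$ is a Lindelöf clopen cone on some point of $I_\beta(X)$, and $\mathbb B_x=\{\{x\}\cup\bigcup_{\xi\le\nu<\omega_1}U_\nu:\xi<\omega_1\}$. An LLSP space $X$ is admissible if one can choose a neighbourhood basis $\mathbb B_x$ for each $x\in X$ such that for every $\beta$ with $\beta+1<\mathrm{ht}(X)$: (1) for every $x\in I_{\beta+1}(X)$, $\mathbb B_x$ is an admissible basis for $x$ (given by some family); (2) if $x\neq y$ are points of $I_{\beta+1}(X)$, $\mathbb B_x$ is given by $\{U_\nu:\nu<\omega_1\}$ and $\mathbb B_y$ is given by $\{U'_\nu:\nu<\omega_1\}$, then $U_\nu\cap U'_\mu=\emptyset$ for all $\nu,\mu<\omega_1$. **Theorem 3.3 (stepping-up).** Let $\lambda\ge\omega_2$ be a cardinal. If there is a good $(\omega_1,\lambda)$-LLSP space that is admissible, then for every ordinal $\alpha$ with $0<\alpha<\lambda^+$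 there is a good $(\omega_1,\alpha)$-LLSP space. -/

import Mathlib

open Set Filter Topology

universe u

namespace LLSP

/-- The `α`-th Cantor–Bendixson derivative of the space `X`. -/
def cbDeriv (X : Type u) [TopologicalSpace X] (α : Ordinal.{u}) : Set X :=
  CantorBendixson.iteratedDerivedSet (Set.univ : Set X) α

/-- `X` is scattered: some Cantor–Bendixson derivative of `X` is empty. -/
def IsScattered (X : Type u) [TopologicalSpace X] : Prop :=
  ∃ α : Ordinal.{u}, cbDeriv X α = ∅

/-- The height of `X`: the least `α` whose Cantor–Bendixson derivative is empty
(meaningful for scattered `X`). -/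
noncomputable def height (X : Type u) [TopologicalSpace X] : Ordinal.{u} :=
  sInf {α : Ordinal.{u} | cbDeriv X α = ∅}

/-- The `α`-th Cantor–Bendixson level of `X`. -/
def level (X : Type u) [TopologicalSpace X] (α : Ordinal.{u}) : Set X :=
  cbDeriv X α \ cbDeriv X (α + 1)

/-- The ordinal `α` such that `x` lies in the `α`-th level; it exists and is unique when the
space is scattered. -/
noncomputable def rank {X : Type u} [TopologicalSpace X] (x : X) : Ordinal.{u} :=
  sInf {α : Ordinal.{u} | x ∈ level X α}

/-- The width of `X`: the supremum of the cardinalities of its levels below the height. The set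
is bounded above by the cardinality of `X`, so the supremum is a genuine one. -/
noncomputable def width (X : Type u) [TopologicalSpace X] : Cardinal.{u} :=
  sSup {c : Cardinal.{u} | ∃ α < height X, c = Cardinal.mk (level X α)}

/-- `X` is a P-space: countable intersections of open sets are open. -/
def IsPSpace (X : Type u) [TopologicalSpace X] : Prop :=
  ∀ S : Set (Set X), S.Countable → (∀ s ∈ S, IsOpen s) → IsOpen (⋂₀ S)

/-- Every point has a Lindelöf neighbourhood. -/
def IsLocallyLindelof (X : Type u) [TopologicalSpace X] : Prop :=
  ∀ x : X, ∃ K ∈ 𝓝 x, IsLindelof K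

/-- LLSP spaces: locally Lindelöf, scattered, Hausdorff P-spaces. -/
structure IsLLSP (X : Type u) [TopologicalSpace X] : Prop where
  locallyLindelof : IsLocallyLindelof X
  scattered : IsScattered X
  hausdorff : T2Space X
  pSpace : IsPSpace X

/-- `(κ, α)`-LLSP spaces: LLSP spaces of width `κ` and height `α`. -/
structure IsLLSPOf (κ : Cardinal.{u}) (α : Ordinal.{u}) (X : Type u) [TopologicalSpace X] :
    Prop extends IsLLSP X where
  height_eq : height X = α
  width_eq : width X = κ

/-- `U` is a cone on `x`: a neighbourhood of `x` in which `x` is the only point of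
level `≥` that of `x`. -/
def IsCone {X : Type u} [TopologicalSpace X] (U : Set X) (x : X) : Prop :=
  U ∈ 𝓝 x ∧ ∀ y ∈ U, rank x ≤ rank y → y = x

/-- `U` is a Lindelöf clopen cone on `x`. -/
def IsLCCone {X : Type u} [TopologicalSpace X] (U : Set X) (x : X) : Prop :=
  IsLindelof U ∧ IsClopen U ∧ IsCone U x

/-- `X` is good: no countable family of Lindelöf clopen cones on points of `X` covers all but
countably many points of some level below the height. -/
def IsGood (X : Type u) [TopologicalSpace X] : Prop :=
  ∀ α < height X, ∀ U : ℕ → Set X, (∀ n, ∃ x, IsLCCone (U n) x) →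
    ¬ (level X α \ ⋃ n, U n).Countable

/-- The index set of the countable ordinals. -/
abbrev CountableOrdinals : Type 1 := Set.Iio (Ordinal.omega.{0} 1)

/-- `B` is the admissible basis for the point `x` of level `β + 1` given by the family
`U ν`, `ν < ω₁`. -/
structure IsAdmissibleBasisBy {X : Type u} [TopologicalSpace X] (β : Ordinal.{u}) (x : X)
    (B : Set (Set X)) (U : CountableOrdinals → Set X) : Prop where
  disjoint : Pairwise fun ν μ => Disjoint (U ν) (U μ)
  cone : ∀ ν, ∃ y ∈ level X β, IsLCCone (U ν) y
  eq : B = {W : Set X | ∃ ξ : CountableOrdinals, W = {x} ∪ ⋃ ν ≥ ξ, U ν}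

/-- `X` is an admissible space. -/
def IsAdmissible (X : Type u) [TopologicalSpace X] : Prop :=
  ∃ B : X → Set (Set X), (∀ x, (𝓝 x).HasBasis (fun W => W ∈ B x) id) ∧
    ∀ β : Ordinal.{u}, β + 1 < height X →
      (∀ x ∈ level X (β + 1), ∃ U, IsAdmissibleBasisBy β x (B x) U) ∧
      (∀ x ∈ level X (β + 1), ∀ y ∈ level X (β + 1), x ≠ y →
        ∀ U U' : CountableOrdinals → Set X,
          IsAdmissibleBasisBy β x (B x) U → IsAdmissibleBasisBy β y (B y) U' →
            ∀ ν μ, Disjoint (U ν) (U' μ))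

end LLSP

/-!
The space of height `α` is built by induction on `α`, by resolving the points of the given
admissible space `X` of height `λ`.

Suppose that a space `K x` and a map `f x : X → K x`, continuous off `x`, are given for every
point `x` of `X`. In the resolution of `X`, each `x` is replaced by a copy of `K x`, and the basic
neighbourhoods of a point `z` of this copy consist of an open set `W ∋ z` of `K x` and of the
fibres over all points `y ≠ x` of a neighbourhood of `x` with `f x y ∈ W`. Resolutions of Hausdorff
P-spaces into Hausdorff P-spaces are Hausdorff P-spaces, and if the `K x` are Lindelöf then
preimages of Lindelöf sets under the projection are Lindelöf
(`Resolution.isLindelof_preimage_proj`). If `f x` takes values in every nonempty open subset of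
`K x` at points arbitrarily close to `x` and of rank cofinal in that of `x`, then the ranks of the
fibre over `x` are obtained by adding the ranks in `K x` to the supremum of the ranks
that occur over points of smaller rank (`Resolution.isRankFunction`).

Here `K x` is the one-point Lindelöfication of a good space `Z`. As `Z` is good, the added point
has rank the height of `Z` (`Lindelofication.isRankFunction_rk`). The points of rank `β + 1` of
`X` are resolved into the Lindelöfication of a space of height `F β`, where `F` maps `λ` onto `α`;
all other points are left alone. The maps `f x` come from admissibility: `x` is the limit of `ω₁`
disjoint Lindelöf open sets, on each of which `f x` is constant, each point of the lowest level of
`K x` being the value on uncountably many of them (`IsAdmissibleBasisBy.exists_map`). A level of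
the resolution lies over a single level of `X`, which gives the bound `ℵ₁` on its size. It remains
uncountable when countably many Lindelöf sets are removed, because their projections are Lindelöf
in `X`, hence covered by countably many Lindelöf clopen cones of the good space `X`
(`IsGood.not_countable_diff`). So the resolution is good, and its height is at least `α`. Its
points of rank below `α` form the required space (`IsGoodThin.exists_of_lt`).
-/

namespace LLSP

/-! ### Rank functions -/

section

variable {X : Type u} [TopologicalSpace X]

/-- A function on the points of `X` that satisfies the two local conditions characterising the
Cantor–Bendixson rank: near `x` all other points have smaller value, and the values of points
near `x` are cofinal in `ρ x`. -/
def IsRankFunction (ρ : X → Ordinal.{u}) : Prop :=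
  ∀ x, (∀ᶠ y in 𝓝[≠] x, ρ y < ρ x) ∧ ∀ γ < ρ x, ∃ᶠ y in 𝓝[≠] x, γ ≤ ρ y

theorem isRankFunction_iff {ρ : X → Ordinal.{u}} :
    IsRankFunction ρ ↔ ∀ x, (∃ U ∈ 𝓝 x, ∀ y ∈ U, y ≠ x → ρ y < ρ x) ∧
      ∀ γ < ρ x, ∀ U ∈ 𝓝 x, ∃ y ∈ U, y ≠ x ∧ γ ≤ ρ y := by
  refine forall_congr' fun x => and_congr ?_ (forall₂_congr fun γ _ => ?_)
  · rw [eventually_nhdsWithin_iff, eventually_iff_exists_mem]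
    rfl
  · rw [frequently_nhdsWithin_iff, frequently_iff]
    simp only [mem_compl_iff, mem_singleton_iff, and_comm]

theorem cbDeriv_add_one (α : Ordinal.{u}) :
    cbDeriv X (α + 1) = {x | (∃ᶠ y in 𝓝[≠] x, y ∈ cbDeriv X α) ∧ x ∈ cbDeriv X α} := by
  ext x
  simp [cbDeriv, accPt_iff_frequently_nhdsNE]

theorem cbDeriv_antitone : Antitone (cbDeriv X) :=
  CantorBendixson.iteratedDerivedSet_antitone _

theorem mem_cbDeriv_of_isSuccLimit {α : Ordinal.{u}} (hα : Order.IsSuccLimit α) {x : X} :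
    x ∈ cbDeriv X α ↔ ∀ β < α, x ∈ cbDeriv X β := by
  simp [cbDeriv, CantorBendixson.iteratedDerivedSet_limit hα]

namespace IsRankFunction

variable {ρ : X → Ordinal.{u}} (h : IsRankFunction ρ)
include h

theorem cbDeriv_eq (α : Ordinal.{u}) : cbDeriv X α = {x | α ≤ ρ x} := by
  induction α using Ordinal.limitRecOn with
  | zero => simp [cbDeriv]
  | add_one α ih =>
    ext x
    rw [cbDeriv_add_one, ih]
    simp only [mem_ofPred_eq, Order.add_one_le_iff]
    constructor
    · rintro ⟨h1, h2⟩
      obtain ⟨y, hy1, hy2⟩ := (h1.and_eventually (h x).1).exists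
      exact hy1.trans_lt hy2
    · intro hx
      exact ⟨(h x).2 α hx, hx.le⟩
  | limit α hα ih =>
    ext x
    rw [mem_cbDeriv_of_isSuccLimit hα]
    constructor
    · intro hx
      refine (hα.le_iff_forall_le).2 fun β hβ => ?_
      have := hx β hβ
      rwa [ih β hβ] at this
    · intro hx β hβ
      rw [ih β hβ]
      exact hβ.le.trans hx

theorem level_eq (α : Ordinal.{u}) : level X α = {x | ρ x = α} := by
  ext x
  simp only [level, h.cbDeriv_eq, Set.mem_sdiff, mem_ofPred_eq, Order.add_one_le_iff, not_lt]
  exact ⟨fun hx => le_antisymm hx.2 hx.1, fun hx => ⟨hx.ge, hx.le⟩⟩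

theorem cbDeriv_eq_empty_iff (α : Ordinal.{u}) : cbDeriv X α = ∅ ↔ ∀ x, ρ x < α := by
  simp [h.cbDeriv_eq, Set.eq_empty_iff_forall_notMem]

theorem isScattered : IsScattered X := by
  refine ⟨⨆ x, (ρ x + 1), (h.cbDeriv_eq_empty_iff _).2 fun x => ?_⟩
  exact (Order.lt_add_one_iff.2 le_rfl).trans_le (Ordinal.le_iSup (fun x => ρ x + 1) x)

theorem height_le_iff (α : Ordinal.{u}) : height X ≤ α ↔ ∀ x, ρ x < α := by
  constructor
  · intro hα x
    have := csInf_mem (s := {α : Ordinal.{u} | cbDeriv X α = ∅}) h.isScattered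
    exact ((h.cbDeriv_eq_empty_iff _).1 this x).trans_le hα
  · intro hα
    exact csInf_le' ((h.cbDeriv_eq_empty_iff _).2 hα)

end IsRankFunction

theorem IsRankFunction.exists_eq_zero_mem {ρ : X → Ordinal.{u}}
    (h : IsRankFunction ρ) {W : Set X} (hW : IsOpen W) (hne : W.Nonempty) :
    ∃ x ∈ W, ρ x = 0 := by
  -- A point of `W` of least rank is isolated.
  obtain ⟨x, hx, hmin⟩ := exists_minimalFor_of_wellFoundedLT (· ∈ W) ρ hne
  refine ⟨x, hx, ?_⟩
  by_contra h0
  obtain ⟨⟨U, hU, h1⟩, h2⟩ := isRankFunction_iff.1 h x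
  obtain ⟨y, hy, hyx, -⟩ := h2 0 (pos_iff_ne_zero.2 h0) _ (inter_mem hU (hW.mem_nhds hx))
  exact (h1 y hy.1 hyx).not_ge (hmin hy.2 (h1 y hy.1 hyx).le)

theorem IsScattered.mem_cbDeriv_iff (h : IsScattered X) (x : X) (α : Ordinal.{u}) :
    x ∈ cbDeriv X α ↔ α ≤ rank x := by
  -- `x` leaves the derivatives at a successor stage, so it belongs to some level.
  obtain ⟨γ, hγ⟩ : ∃ γ : Ordinal.{u}, x ∈ level X γ := by
    by_contra! hne
    obtain ⟨δ, hδ⟩ := h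
    have : ∀ α : Ordinal.{u}, x ∈ cbDeriv X α := by
      intro α
      induction α using Ordinal.limitRecOn with
      | zero => simp [cbDeriv]
      | add_one α ih =>
        by_contra hx
        exact hne α ⟨ih, hx⟩
      | limit α hα ih => exact (mem_cbDeriv_of_isSuccLimit hα).2 ih
    have := this δ
    rw [hδ] at this
    exact this
  have hlev : ∀ β : Ordinal.{u}, x ∈ cbDeriv X β ↔ β ≤ γ := by
    intro β
    constructor
    · intro hβ
      by_contra! hlt
      exact hγ.2 (cbDeriv_antitone (Order.add_one_le_of_lt hlt) hβ)
    · intro hβ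
      exact cbDeriv_antitone hβ hγ.1
  have hr : rank x = γ := by
    have : {α : Ordinal.{u} | x ∈ level X α} = {γ} := by
      ext β
      simp only [level, Set.mem_sdiff, mem_ofPred_eq, hlev, Order.add_one_le_iff, not_lt,
        mem_singleton_iff]
      exact ⟨fun hx => le_antisymm hx.1 hx.2, fun hx => ⟨hx.le, hx.ge⟩⟩
    rw [rank, this, csInf_singleton]
  rw [hlev, hr]

theorem IsScattered.isRankFunction_rank (h : IsScattered X) :
    IsRankFunction (rank : X → Ordinal.{u}) := by
  intro x
  have hx : x ∉ cbDeriv X (rank x + 1) := by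
    rw [h.mem_cbDeriv_iff]; simp
  constructor
  · rw [cbDeriv_add_one] at hx
    have h2 : x ∈ cbDeriv X (rank x) := (h.mem_cbDeriv_iff _ _).2 le_rfl
    have h3 : ¬ ∃ᶠ y in 𝓝[≠] x, y ∈ cbDeriv X (rank x) := fun h3 => hx ⟨h3, h2⟩
    rw [not_frequently] at h3
    filter_upwards [h3] with y hy
    rwa [h.mem_cbDeriv_iff, not_le] at hy
  · intro γ hγ
    have := (h.mem_cbDeriv_iff x (γ + 1)).2 (Order.add_one_le_of_lt hγ)
    rw [cbDeriv_add_one] at this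
    exact this.1.mono fun y hy => (h.mem_cbDeriv_iff _ _).1 hy

theorem IsScattered.rank_lt_height (h : IsScattered X) (x : X) : rank x < height X :=
  (h.isRankFunction_rank.height_le_iff _).1 le_rfl x

theorem IsScattered.exists_rank_ge (h : IsScattered X) {α : Ordinal.{u}} (hα : α < height X) :
    ∃ x : X, α ≤ rank x := by
  by_contra! hne
  exact hα.not_ge ((h.isRankFunction_rank.height_le_iff _).2 hne)

theorem IsScattered.level_eq (h : IsScattered X) (α : Ordinal.{u}) :
    level X α = {x | rank x = α} := h.isRankFunction_rank.level_eq α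

theorem IsCone.of_subset {U V : Set X} {x : X} (hU : IsCone U x) (hV : V ∈ 𝓝 x)
    (hVU : V ⊆ U) : IsCone V x :=
  ⟨hV, fun y hy => hU.2 y (hVU hy)⟩

theorem IsScattered.exists_isCone (h : IsScattered X) (x : X) : ∃ U : Set X, IsCone U x := by
  have := (h.isRankFunction_rank x).1
  rw [eventually_nhdsWithin_iff] at this
  refine ⟨_, this, fun y hy hxy => ?_⟩
  by_contra hne
  exact (hy hne).not_ge hxy

end

/-! ### Lindelöf sets and clopen cones -/

section

variable {X : Type u} [TopologicalSpace X]

theorem IsPSpace.countableInterFilter_nhds (h : IsPSpace X) (x : X) :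
    CountableInterFilter (𝓝 x) := by
  refine ⟨fun S hS hmem => ?_⟩
  have ho : IsOpen (⋂₀ (interior '' S)) :=
    h _ (hS.image _) (by rintro _ ⟨s, -, rfl⟩; exact isOpen_interior)
  refine mem_of_superset (ho.mem_nhds ?_) ?_
  · rintro _ ⟨s, hs, rfl⟩
    exact mem_interior_iff_mem_nhds.2 (hmem s hs)
  · intro y hy s hs
    exact interior_subset (hy _ ⟨s, hs, rfl⟩)

theorem IsPSpace.of_countableInterFilter_nhds (h : ∀ x : X, CountableInterFilter (𝓝 x)) :
    IsPSpace X := by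
  intro S hS ho
  refine isOpen_iff_mem_nhds.2 fun x hx => ?_
  have := h x
  exact (countable_sInter_mem hS).2 fun s hs => (ho s hs).mem_nhds (hx s hs)

theorem IsPSpace.isClosed_of_isLindelof [T2Space X] (h : IsPSpace X) {L : Set X}
    (hL : IsLindelof L) : IsClosed L := by
  refine isOpen_compl_iff.1 (isOpen_iff_mem_nhds.2 fun x hx => ?_)
  have := h.countableInterFilter_nhds x
  have hd : Disjoint (𝓝ˢ L) (𝓝 x) := hL.disjoint_nhdsSet_left.2 fun y hy =>
    disjoint_nhds_nhds.2 fun hyx => hx (hyx ▸ hy)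
  obtain ⟨s, hs, t, ht, hst⟩ := Filter.disjoint_iff.1 hd
  refine mem_of_superset ht fun y hy hyL => ?_
  exact Set.disjoint_left.1 hst (subset_of_mem_nhdsSet hs hyL) hy

/-- In a locally Lindelöf Hausdorff P-space the Lindelöf clopen sets form a base: inside a
Lindelöf neighbourhood one can shrink an open set to one whose closure it contains, and the
intersection of countably many successive shrinkings is both open and closed. -/
theorem IsLLSP.exists_isLindelof_isClopen (h : IsLLSP X) {x : X} {U : Set X} (hU : U ∈ 𝓝 x) :
    ∃ V ⊆ U, IsLindelof V ∧ IsClopen V ∧ x ∈ V := by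
  have := h.hausdorff
  obtain ⟨L, hLx, hL⟩ := h.locallyLindelof x
  have hLc : IsClosed L := h.pSpace.isClosed_of_isLindelof hL
  have := h.pSpace.countableInterFilter_nhds x
  have shrink : ∀ O : {O : Set X // IsOpen O ∧ x ∈ O ∧ O ⊆ L},
      ∃ O' : {O : Set X // IsOpen O ∧ x ∈ O ∧ O ⊆ L}, closure O'.1 ⊆ O.1 := by
    rintro ⟨O, hO, hxO, hOL⟩
    have hd : Disjoint (𝓝ˢ (L \ O)) (𝓝 x) := (hL.diff hO).disjoint_nhdsSet_left.2 fun y hy =>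
      disjoint_nhds_nhds.2 fun hyx => hy.2 (hyx ▸ hxO)
    obtain ⟨s, hs, t, ht, hst⟩ := Filter.disjoint_iff.1 hd
    obtain ⟨A, hA, hLA, hAs⟩ := mem_nhdsSet_iff_exists.1 hs
    refine ⟨⟨interior t ∩ O, isOpen_interior.inter hO,
      ⟨mem_interior_iff_mem_nhds.2 ht, hxO⟩, fun y hy => hOL hy.2⟩, fun y hy => ?_⟩
    have hyL : y ∈ L := closure_minimal (fun y hy => hOL hy.2) hLc hy
    have hyA : y ∈ Aᶜ := closure_minimal (t := Aᶜ)
      (fun z hz hzA => Set.disjoint_left.1 hst (hAs hzA) (interior_subset hz.1))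
      hA.isClosed_compl hy
    by_contra hyO
    exact hyA (hLA ⟨hyL, hyO⟩)
  choose g hg using shrink
  let O₀ : {O : Set X // IsOpen O ∧ x ∈ O ∧ O ⊆ L} :=
    ⟨interior (U ∩ L), isOpen_interior, mem_interior_iff_mem_nhds.2 (inter_mem hU hLx),
      fun y hy => (interior_subset hy).2⟩
  let O : ℕ → {O : Set X // IsOpen O ∧ x ∈ O ∧ O ⊆ L} := fun n => g^[n] O₀
  have hstep : ∀ n, closure (O (n + 1)).1 ⊆ (O n).1 := by
    intro n
    have : O (n + 1) = g (O n) := Function.iterate_succ_apply' g n O₀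
    rw [this]
    exact hg _
  have hcl : (⋂ n, (O n).1) = ⋂ n, closure (O n).1 := by
    refine subset_antisymm (iInter_mono fun n => subset_closure) ?_
    refine subset_iInter fun n => (iInter_subset _ (n + 1)).trans (hstep n)
  have hclosed : IsClosed (⋂ n, (O n).1) := by
    rw [hcl]; exact isClosed_iInter fun n => isClosed_closure
  have hopen : IsOpen (⋂ n, (O n).1) := by
    rw [← sInter_range]
    exact h.pSpace _ (countable_range _) (by rintro _ ⟨n, rfl⟩; exact (O n).2.1)
  refine ⟨⋂ n, (O n).1, ?_, hL.of_isClosed_subset hclosed ?_, ⟨hclosed, hopen⟩,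
    mem_iInter.2 fun n => (O n).2.2.1⟩
  · exact (iInter_subset _ 0).trans fun y hy => (interior_subset hy).1
  · exact (iInter_subset _ 0).trans (O 0).2.2.2

theorem IsLLSP.exists_isLCCone (h : IsLLSP X) (x : X) : ∃ U : Set X, IsLCCone U x := by
  obtain ⟨C, hC⟩ := h.scattered.exists_isCone x
  obtain ⟨V, hVC, hV, hVclopen, hxV⟩ := h.exists_isLindelof_isClopen hC.1
  exact ⟨V, hV, hVclopen, hC.of_subset (hVclopen.isOpen.mem_nhds hxV) hVC⟩

/-- The defining property of a good space, for arbitrary Lindelöf sets in place of cones: in an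
LLSP space every Lindelöf set is covered by countably many Lindelöf clopen cones. -/
theorem IsGood.not_countable_diff (hg : IsGood X) (h : IsLLSP X) {α : Ordinal.{u}}
    (hα : α < height X) {L : ℕ → Set X} (hL : ∀ n, IsLindelof (L n)) :
    ¬ (level X α \ ⋃ n, L n).Countable := by
  choose C hC using h.exists_isLCCone
  obtain ⟨x₀, -⟩ := h.scattered.exists_rank_ge hα
  obtain ⟨t, ht, -, hLt⟩ := (isLindelof_iUnion hL).elim_nhds_subcover C fun x _ => (hC x).2.2.1
  obtain ⟨s, hs⟩ : ∃ s : ℕ → X, insert x₀ t = range s :=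
    (ht.insert x₀).exists_eq_range (insert_nonempty _ _)
  intro hcount
  refine hg α hα (fun n => C (s n)) (fun n => ⟨_, hC _⟩) (hcount.mono ?_)
  refine sdiff_subset_sdiff_right fun y hy => ?_
  obtain ⟨z, hz, hyz⟩ := mem_iUnion₂.1 (hLt hy)
  obtain ⟨n, rfl⟩ : z ∈ range s := hs ▸ mem_insert_of_mem _ hz
  exact mem_iUnion.2 ⟨n, hyz⟩

theorem IsGood.exists_rank_eq_notMem (hg : IsGood X) (h : IsLLSP X) {α : Ordinal.{u}}
    (hα : α < height X) {L : Set X} (hL : IsLindelof L) : ∃ x ∉ L, rank x = α := by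
  have := hg.not_countable_diff h hα (L := fun _ => L) fun _ => hL
  obtain ⟨x, hx⟩ : (level X α \ ⋃ _ : ℕ, L).Nonempty := by
    by_contra hne
    rw [not_nonempty_iff_eq_empty.1 hne] at this
    exact this countable_empty
  rw [h.scattered.level_eq, iUnion_const] at hx
  exact ⟨x, hx.2, hx.1⟩

/-- The points of rank below `α`, as a space. -/
abbrev Below (X : Type u) [TopologicalSpace X] (α : Ordinal.{u}) : Type u :=
  ↥{x : X | rank x < α}

theorem IsScattered.isOpen_below (h : IsScattered X) (α : Ordinal.{u}) :
    IsOpen {x : X | rank x < α} := by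
  refine isOpen_iff_mem_nhds.2 fun x hx => ?_
  have := (h.isRankFunction_rank x).1
  rw [eventually_nhdsWithin_iff] at this
  filter_upwards [this] with y hy
  by_cases hyx : y = x
  · rwa [hyx]
  · exact (hy hyx).trans hx

theorem IsScattered.isRankFunction_below (h : IsScattered X) (α : Ordinal.{u}) :
    IsRankFunction (fun x : Below X α => rank x.1) := by
  have hemb : IsOpenEmbedding (Subtype.val : Below X α → X) :=
    (h.isOpen_below α).isOpenEmbedding_subtypeVal
  rintro x
  have hmap : map Subtype.val (𝓝[≠] x) = 𝓝[≠] x.1 := by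
    rw [hemb.isEmbedding.map_nhdsWithin_eq]
    have : (Subtype.val '' {x}ᶜ : Set X) = {x.1}ᶜ ∩ {y | rank y < α} := by
      ext y
      simp only [mem_image, mem_compl_iff, mem_singleton_iff, mem_inter_iff, mem_ofPred_eq]
      constructor
      · rintro ⟨z, hz, rfl⟩
        exact ⟨fun hzx => hz (Subtype.ext hzx), z.2⟩
      · rintro ⟨hy, hyα⟩
        exact ⟨⟨y, hyα⟩, fun hyx => hy (congrArg Subtype.val hyx), rfl⟩
    rw [this, nhdsWithin_inter_of_mem']
    exact mem_nhdsWithin_of_mem_nhds ((h.isOpen_below α).mem_nhds x.2)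
  have := h.isRankFunction_rank x.1
  rw [← hmap] at this
  exact this

theorem IsScattered.level_below (h : IsScattered X) {α β : Ordinal.{u}} (hβ : β < α) :
    Subtype.val '' level (Below X α) β = level X β := by
  rw [(h.isRankFunction_below α).level_eq, h.level_eq]
  ext x
  constructor
  · rintro ⟨y, hy, rfl⟩
    exact hy
  · intro hx
    exact ⟨⟨x, lt_of_eq_of_lt hx hβ⟩, hx, rfl⟩

theorem IsLLSP.below (h : IsLLSP X) (α : Ordinal.{u}) : IsLLSP (Below X α) where
  locallyLindelof := by
    intro x
    obtain ⟨V, hV, hVL, hVc, hxV⟩ :=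
      h.exists_isLindelof_isClopen ((h.scattered.isOpen_below α).mem_nhds x.2)
    refine ⟨Subtype.val ⁻¹' V, (hVc.isOpen.preimage continuous_subtype_val).mem_nhds hxV, ?_⟩
    rw [Subtype.isLindelof_iff, Subtype.image_preimage_coe, inter_eq_right.2 hV]
    exact hVL
  scattered := (h.scattered.isRankFunction_below α).isScattered
  hausdorff := by
    have := h.hausdorff
    infer_instance
  pSpace := by
    refine IsPSpace.of_countableInterFilter_nhds fun x => ?_
    have := h.pSpace.countableInterFilter_nhds x.1
    rw [nhds_induced]
    infer_instance

theorem IsScattered.height_below (h : IsScattered X) {α : Ordinal.{u}} (hα : α ≤ height X)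
    (hlev : ∀ β < height X, (level X β).Nonempty) : height (Below X α) = α := by
  refine le_antisymm (((h.isRankFunction_below α).height_le_iff _).2 fun x => x.2) ?_
  refine le_of_forall_lt fun β hβ => ?_
  obtain ⟨x, hx⟩ := hlev β (hβ.trans_le hα)
  rw [h.level_eq] at hx
  have hx : rank x = β := hx
  have := ((h.isRankFunction_below α).height_le_iff _).1 le_rfl ⟨x, hx.trans_lt hβ⟩
  exact hx ▸ this

theorem IsGood.level_nonempty (hg : IsGood X) (h : IsLLSP X) (β : Ordinal.{u})
    (hβ : β < height X) : (level X β).Nonempty := by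
  obtain ⟨x, -, hx⟩ := hg.exists_rank_eq_notMem h hβ isLindelof_empty
  exact ⟨x, by rw [h.scattered.level_eq]; exact hx⟩

theorem IsGood.below (hg : IsGood X) (h : IsLLSP X) {α : Ordinal.{u}} (hα : α ≤ height X) :
    IsGood (Below X α) := by
  intro β hβ U hU hcount
  rw [h.scattered.height_below hα (hg.level_nonempty h)] at hβ
  refine hg.not_countable_diff h (hβ.trans_le hα) (L := fun n => Subtype.val '' U n)
    (fun n => ?_) ((hcount.image Subtype.val).mono ?_)
  · obtain ⟨x, hx⟩ := hU n
    exact hx.1.image continuous_subtype_val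
  · rw [← h.scattered.level_below hβ, ← image_iUnion]
    rw [image_sdiff Subtype.val_injective]

end

/-! ### One-point Lindelöfication -/

/-- The one-point Lindelöfication of `Z`: a point `none` is added whose neighbourhoods are the
complements of the closed Lindelöf subsets of `Z`. The point is added even when `Z` is already
Lindelöf, and is then isolated; in particular the Lindelöfication of the empty space is a point. -/
def Lindelofication (Z : Type u) : Type u := Option Z

namespace Lindelofication

variable {Z : Type u}

/-- The inclusion of `Z` in its one-point Lindelöfication. -/
def of (z : Z) : Lindelofication Z := some z

/-- The added point. -/
def infty : Lindelofication Z := none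

theorem of_injective : Function.Injective (of : Z → Lindelofication Z) :=
  Option.some_injective Z

theorem infty_ne_of (z : Z) : infty ≠ of z := (Option.some_ne_none z).symm

theorem eq_infty_or (p : Lindelofication Z) : p = infty ∨ ∃ z, p = of z := by
  cases p with
  | none => exact Or.inl rfl
  | some z => exact Or.inr ⟨z, rfl⟩

theorem infty_mem_compl_image (L : Set Z) : infty ∈ (of '' L : Set (Lindelofication Z))ᶜ := by
  rintro ⟨z, -, hz⟩
  exact infty_ne_of z hz.symm

variable [TopologicalSpace Z]

/-- A set is open if its trace on `Z` is open and, in case it contains the added point, has a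
Lindelöf complement in `Z`; this complement is automatically closed. -/
instance : TopologicalSpace (Lindelofication Z) where
  IsOpen N := IsOpen (of ⁻¹' N) ∧ (infty ∈ N → IsLindelof (of ⁻¹' N)ᶜ)
  isOpen_univ := by simp [isLindelof_empty]
  isOpen_inter := by
    rintro s t ⟨hs, hs'⟩ ⟨ht, ht'⟩
    refine ⟨hs.inter ht, fun h => ?_⟩
    rw [preimage_inter, compl_inter]
    exact (hs' h.1).union (ht' h.2)
  isOpen_sUnion := by
    intro S hS
    have ho : IsOpen (of ⁻¹' ⋃₀ S : Set Z) := by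
      rw [preimage_sUnion]
      exact isOpen_biUnion fun s hs => (hS s hs).1
    refine ⟨ho, ?_⟩
    rintro ⟨s, hs, hinf⟩
    exact ((hS s hs).2 hinf).of_isClosed_subset ho.isClosed_compl
      (compl_subset_compl.2 (preimage_mono (subset_sUnion_of_mem hs)))

theorem isOpen_iff {N : Set (Lindelofication Z)} :
    IsOpen N ↔ IsOpen (of ⁻¹' N) ∧ (infty ∈ N → IsLindelof (of ⁻¹' N)ᶜ) := Iff.rfl

theorem isOpenEmbedding_of : IsOpenEmbedding (of : Z → Lindelofication Z) := by
  refine IsOpenEmbedding.of_continuous_injective_isOpenMap ⟨fun s hs => hs.1⟩ of_injective ?_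
  intro s hs
  refine isOpen_iff.2 ⟨by rwa [preimage_image_eq _ of_injective], ?_⟩
  rintro ⟨z, -, hz⟩
  exact (infty_ne_of z hz.symm).elim

theorem isOpen_compl_image {L : Set Z} (hL : IsLindelof L) (hLc : IsClosed L) :
    IsOpen (of '' L : Set (Lindelofication Z))ᶜ := by
  rw [isOpen_iff, preimage_compl, preimage_image_eq _ of_injective, compl_compl]
  exact ⟨hLc.isOpen_compl, fun _ => hL⟩

theorem exists_isLindelof_of_mem_nhds_infty {N : Set (Lindelofication Z)}
    (hN : N ∈ 𝓝 infty) : ∃ L : Set Z, IsLindelof L ∧ ∀ z ∉ L, of z ∈ N := by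
  obtain ⟨O, hON, hO, hinf⟩ := mem_nhds_iff.1 hN
  exact ⟨(of ⁻¹' O)ᶜ, hO.2 hinf, fun z hz => hON (by simpa using hz)⟩

theorem t2Space (h : IsLLSP Z) : T2Space (Lindelofication Z) := by
  have := h.hausdorff
  -- A point of `Z` is separated from the added point by a Lindelöf clopen neighbourhood.
  have key : ∀ z : Z, ∃ u v : Set (Lindelofication Z), IsOpen u ∧ IsOpen v ∧ of z ∈ u ∧
      infty ∈ v ∧ Disjoint u v := by
    intro z
    obtain ⟨V, -, hVL, hV, hz⟩ := h.exists_isLindelof_isClopen (univ_mem : univ ∈ 𝓝 z)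
    exact ⟨of '' V, (of '' V)ᶜ, isOpenEmbedding_of.isOpenMap _ hV.isOpen,
      isOpen_compl_image hVL hV.isClosed, mem_image_of_mem _ hz, infty_mem_compl_image V,
      disjoint_compl_right⟩
  refine ⟨fun p q hpq => ?_⟩
  rcases eq_infty_or p with rfl | ⟨z, rfl⟩ <;> rcases eq_infty_or q with rfl | ⟨w, rfl⟩
  · exact (hpq rfl).elim
  · obtain ⟨u, v, hu, hv, hzu, hv', huv⟩ := key w
    exact ⟨v, u, hv, hu, hv', hzu, huv.symm⟩
  · exact key z
  · obtain ⟨u, v, hu, hv, hz, hw, huv⟩ := t2_separation (fun h => hpq (congrArg of h) : z ≠ w)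
    exact ⟨of '' u, of '' v, isOpenEmbedding_of.isOpenMap _ hu, isOpenEmbedding_of.isOpenMap _ hv,
      mem_image_of_mem _ hz, mem_image_of_mem _ hw, (disjoint_image_iff of_injective).2 huv⟩

theorem isPSpace (h : IsPSpace Z) : IsPSpace (Lindelofication Z) := by
  intro S hS ho
  have hpre : of ⁻¹' ⋂₀ S = ⋂₀ ((fun s => (of ⁻¹' s : Set Z)) '' S) := by
    ext z
    simp
  refine isOpen_iff.2 ⟨?_, fun hinf => ?_⟩
  · rw [hpre]
    exact h _ (hS.image _) (by rintro _ ⟨s, hs, rfl⟩; exact (ho s hs).1)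
  · rw [hpre, sInter_image, compl_iInter₂]
    exact hS.isLindelof_biUnion fun s hs => (ho s hs).2 (hinf s hs)

theorem isLindelof_univ : IsLindelof (univ : Set (Lindelofication Z)) := by
  refine isLindelof_of_countable_subcover fun {ι} U hU hcov => ?_
  obtain ⟨i, hi⟩ := mem_iUnion.1 (hcov (mem_univ infty))
  have hL : IsLindelof (of '' (of ⁻¹' U i)ᶜ) :=
    ((hU i).2 hi).image isOpenEmbedding_of.continuous
  obtain ⟨t, ht, hsub⟩ := hL.elim_countable_subcover U hU fun p _ => hcov (mem_univ p)
  refine ⟨insert i t, ht.insert i, fun p _ => ?_⟩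
  rw [biUnion_insert]
  by_cases hp : p ∈ U i
  · exact Or.inl hp
  · refine Or.inr (hsub ?_)
    rcases eq_infty_or p with rfl | ⟨z, rfl⟩
    · exact (hp hi).elim
    · exact mem_image_of_mem _ hp

variable (Z) in
/-- The Cantor–Bendixson rank of the Lindelöfication of a good space. -/
noncomputable def rk (p : Lindelofication Z) : Ordinal.{u} :=
  Option.elim p (height Z) rank

theorem rk_infty : rk Z infty = height Z := rfl

/-- By goodness no Lindelöf subset of `Z` contains a whole level, so the added point has rank
the height of `Z`. -/
theorem isRankFunction_rk (h : IsLLSP Z) (hg : IsGood Z) : IsRankFunction (rk Z) := by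
  rw [isRankFunction_iff]
  intro p
  rcases eq_infty_or p with rfl | ⟨z, rfl⟩
  · refine ⟨⟨univ, univ_mem, fun q _ hq => ?_⟩, fun γ hγ U hU => ?_⟩
    · rcases eq_infty_or q with rfl | ⟨w, rfl⟩
      · exact (hq rfl).elim
      · exact h.scattered.rank_lt_height w
    · obtain ⟨L, hL, hLU⟩ := exists_isLindelof_of_mem_nhds_infty hU
      obtain ⟨w, hw, hwγ⟩ := hg.exists_rank_eq_notMem h hγ hL
      exact ⟨of w, hLU w hw, (infty_ne_of w).symm, hwγ.ge⟩
  · obtain ⟨⟨U, hU, h1⟩, h2⟩ := isRankFunction_iff.1 h.scattered.isRankFunction_rank z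
    refine ⟨⟨of '' U, isOpenEmbedding_of.image_mem_nhds.2 hU, ?_⟩, fun γ hγ V hV => ?_⟩
    · rintro _ ⟨y, hy, rfl⟩ hyz
      exact h1 y hy fun h => hyz (congrArg of h)
    · obtain ⟨y, hy, hyz, hγy⟩ :=
        h2 γ hγ (of ⁻¹' V) (isOpenEmbedding_of.continuous.continuousAt hV)
      exact ⟨of y, hy, fun h => hyz (of_injective h), hγy⟩

theorem rk_le_height (h : IsLLSP Z) (p : Lindelofication Z) : rk Z p ≤ height Z := by
  rcases eq_infty_or p with rfl | ⟨z, rfl⟩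
  · exact le_rfl
  · exact (h.scattered.rank_lt_height z).le

theorem exists_rk_eq (h : IsLLSP Z) (hg : IsGood Z) {γ : Ordinal.{u}} (hγ : γ ≤ height Z) :
    ∃ p, rk Z p = γ := by
  rcases hγ.eq_or_lt with rfl | hγ
  · exact ⟨infty, rfl⟩
  · obtain ⟨z, -, hz⟩ := hg.exists_rank_eq_notMem h hγ isLindelof_empty
    exact ⟨of z, hz⟩

end Lindelofication

/-! ### Resolutions -/

/-- The resolution of `X` at each point `x` into the space `K x` by means of the map
`f x : X → K x`, only the values of `f x` off `x` being relevant. -/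
def Resolution {X : Type u} {K : X → Type u} (_f : ∀ x, X → K x) : Type u := Σ x, K x

namespace Resolution

variable {X : Type u} {K : X → Type u} {f : ∀ x, X → K x}

/-- The projection of a resolution that collapses each `K x` to `x`. -/
def proj (p : Resolution f) : X := p.1

/-- The copy in the resolution of the point `z` of `K x`. -/
def mk (x : X) (z : K x) : Resolution f := ⟨x, z⟩

variable (f) in
/-- The part of the resolution above `x` and `W`, together with the fibres over the points `y ≠ x`
of `U` that `f x` maps to `W`. -/
def box (x : X) (U : Set X) (W : Set (K x)) : Set (Resolution f) :=
  {p | (∃ z ∈ W, p = mk x z) ∨ (proj p ∈ U ∧ proj p ≠ x ∧ f x (proj p) ∈ W)}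

theorem mk_injective (x : X) : Function.Injective (mk x : K x → Resolution f) :=
  sigma_mk_injective

theorem mk_mem_box {x : X} {U : Set X} {W : Set (K x)} {z : K x} :
    mk x z ∈ box f x U W ↔ z ∈ W := by
  refine ⟨?_, fun h => Or.inl ⟨z, h, rfl⟩⟩
  rintro (⟨w, hw, h⟩ | ⟨-, h, -⟩)
  · rwa [mk_injective x h]
  · exact (h rfl).elim

theorem mem_box_of_proj_ne {x : X} {U : Set X} {W : Set (K x)} {p : Resolution f}
    (hp : proj p ≠ x) : p ∈ box f x U W ↔ proj p ∈ U ∧ f x (proj p) ∈ W := by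
  refine ⟨?_, fun h => Or.inr ⟨h.1, hp, h.2⟩⟩
  rintro (⟨w, hw, rfl⟩ | ⟨h1, -, h2⟩)
  · exact (hp rfl).elim
  · exact ⟨h1, h2⟩

theorem eq_mk_of_proj_eq {x : X} {p : Resolution f} (hp : proj p = x) : ∃ z, p = mk x z := by
  subst hp
  exact ⟨p.2, rfl⟩

theorem box_mono {x : X} {U U' : Set X} {W W' : Set (K x)} (hU : U ⊆ U') (hW : W ⊆ W') :
    box f x U W ⊆ box f x U' W' := by
  rintro p (⟨z, hz, rfl⟩ | ⟨h1, h2, h3⟩)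
  · exact Or.inl ⟨z, hW hz, rfl⟩
  · exact Or.inr ⟨hU h1, h2, hW h3⟩

variable [TopologicalSpace X] [∀ x, TopologicalSpace (K x)]

/-- The topology of the resolution, in which the boxes over neighbourhoods of `x` and of `z` form
a neighbourhood basis at the copy of `z`, provided that each `f x` is continuous off `x`. -/
instance : TopologicalSpace (Resolution f) where
  IsOpen N := ∀ x z, mk x z ∈ N → ∃ U ∈ 𝓝 x, ∃ W ∈ 𝓝 z, box f x U W ⊆ N
  isOpen_univ := fun _ _ _ => ⟨univ, univ_mem, univ, univ_mem, subset_univ _⟩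
  isOpen_inter := by
    intro s t hs ht x z h
    obtain ⟨U, hU, W, hW, h1⟩ := hs x z h.1
    obtain ⟨U', hU', W', hW', h2⟩ := ht x z h.2
    exact ⟨U ∩ U', inter_mem hU hU', W ∩ W', inter_mem hW hW', subset_inter
      ((box_mono inter_subset_left inter_subset_left).trans h1)
      ((box_mono inter_subset_right inter_subset_right).trans h2)⟩
  isOpen_sUnion := by
    rintro S hS x z ⟨s, hs, h⟩
    obtain ⟨U, hU, W, hW, h1⟩ := hS s hs x z h
    exact ⟨U, hU, W, hW, h1.trans (subset_sUnion_of_mem hs)⟩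

theorem isOpen_iff {N : Set (Resolution f)} :
    IsOpen N ↔ ∀ x z, mk x z ∈ N → ∃ U ∈ 𝓝 x, ∃ W ∈ 𝓝 z, box f x U W ⊆ N := Iff.rfl

theorem continuous_proj : Continuous (proj : Resolution f → X) := by
  refine ⟨fun O hO => isOpen_iff.2 fun x z hx => ?_⟩
  refine ⟨O, hO.mem_nhds hx, univ, univ_mem, ?_⟩
  rintro p (⟨z, -, rfl⟩ | ⟨h, -, -⟩)
  · exact hx
  · exact h

theorem exists_box_subset {x : X} {z : K x} {N : Set (Resolution f)} (hN : N ∈ 𝓝 (mk x z)) :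
    ∃ U ∈ 𝓝 x, ∃ W ∈ 𝓝 z, box f x U W ⊆ N := by
  obtain ⟨O, hON, hO, hz⟩ := mem_nhds_iff.1 hN
  obtain ⟨U, hU, W, hW, h⟩ := hO x z hz
  exact ⟨U, hU, W, hW, h.trans hON⟩

theorem isOpen_box [T1Space X] (hf : ∀ x, ContinuousOn (f x) {x}ᶜ) {x : X} {U : Set X}
    {W : Set (K x)} (hU : IsOpen U) (hx : x ∈ U) (hW : IsOpen W) : IsOpen (box f x U W) := by
  refine isOpen_iff.2 fun y t hy => ?_
  by_cases hyx : y = x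
  · subst hyx
    rw [mk_mem_box] at hy
    exact ⟨U, hU.mem_nhds hx, W, hW.mem_nhds hy, subset_rfl⟩
  · have hy := (mem_box_of_proj_ne (p := mk y t) hyx).1 hy
    refine ⟨U ∩ ({x}ᶜ ∩ f x ⁻¹' W), ?_, univ, univ_mem, ?_⟩
    · exact inter_mem (hU.mem_nhds hy.1)
        (((hf x).isOpen_inter_preimage isOpen_compl_singleton hW).mem_nhds ⟨hyx, hy.2⟩)
    · rintro p (⟨s, -, rfl⟩ | ⟨h1, -, -⟩)
      · exact (mem_box_of_proj_ne (p := mk y s) hyx).2 hy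
      · exact (mem_box_of_proj_ne h1.2.1).2 ⟨h1.1, h1.2.2⟩

theorem box_mem_nhds [T1Space X] (hf : ∀ x, ContinuousOn (f x) {x}ᶜ) {x : X} {z : K x}
    {U : Set X} (hU : U ∈ 𝓝 x) {W : Set (K x)} (hW : W ∈ 𝓝 z) : box f x U W ∈ 𝓝 (mk x z) := by
  refine mem_of_superset (IsOpen.mem_nhds (isOpen_box hf isOpen_interior
    (mem_interior_iff_mem_nhds.2 hU) isOpen_interior)
    (mk_mem_box.2 (mem_interior_iff_mem_nhds.2 hW))) (box_mono interior_subset interior_subset)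

theorem t2Space [T2Space X] [∀ x, T2Space (K x)] (hf : ∀ x, ContinuousOn (f x) {x}ᶜ) :
    T2Space (Resolution f) := by
  refine ⟨fun p q hpq => ?_⟩
  by_cases h : proj p = proj q
  · obtain ⟨w, rfl⟩ := eq_mk_of_proj_eq h.symm
    obtain ⟨x, z⟩ := p
    obtain ⟨u, v, hu, hv, hzu, hwv, huv⟩ :=
      t2_separation (fun h => hpq (congrArg (mk x) h) : z ≠ w)
    refine ⟨_, _, isOpen_box hf isOpen_univ (mem_univ _) hu,
      isOpen_box hf isOpen_univ (mem_univ _) hv, mk_mem_box.2 hzu, mk_mem_box.2 hwv, ?_⟩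
    refine Set.disjoint_left.2 fun r hr hr' => ?_
    by_cases hrp : proj r = x
    · obtain ⟨s, rfl⟩ := eq_mk_of_proj_eq hrp
      exact Set.disjoint_left.1 huv (mk_mem_box.1 hr) (mk_mem_box.1 hr')
    · exact Set.disjoint_left.1 huv ((mem_box_of_proj_ne hrp).1 hr).2
        ((mem_box_of_proj_ne hrp).1 hr').2
  · obtain ⟨u, v, hu, hv, hpu, hqv, huv⟩ := t2_separation h
    exact ⟨_, _, hu.preimage continuous_proj, hv.preimage continuous_proj, hpu, hqv,
      huv.preimage _⟩

theorem isPSpace [T1Space X] (hf : ∀ x, ContinuousOn (f x) {x}ᶜ) (hX : IsPSpace X)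
    (hK : ∀ x, IsPSpace (K x)) : IsPSpace (Resolution f) := by
  refine IsPSpace.of_countableInterFilter_nhds fun p => ⟨fun S hS hmem => ?_⟩
  obtain ⟨z, hz⟩ := eq_mk_of_proj_eq (rfl : proj p = proj p)
  generalize proj p = x at z hz
  subst hz
  have := hX.countableInterFilter_nhds x
  have := (hK x).countableInterFilter_nhds z
  choose! U hU W hW h using fun s hs => exists_box_subset (hmem s hs)
  refine mem_of_superset (box_mem_nhds hf ((countable_bInter_mem hS).2 hU)
    ((countable_bInter_mem hS).2 hW)) fun q hq s hs => h s hs ?_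
  exact box_mono (biInter_subset_of_mem hs) (biInter_subset_of_mem hs) hq

/-- Over a Lindelöf set the resolution into Lindelöf spaces is Lindelöf: countably many members of
an open cover already cover a fibre, hence, in a P-space, the preimage of a neighbourhood. -/
theorem isLindelof_preimage_proj (hX : IsPSpace X) (hK : ∀ x, IsLindelof (univ : Set (K x)))
    {L : Set X} (hL : IsLindelof L) : IsLindelof (proj ⁻¹' L : Set (Resolution f)) := by
  refine isLindelof_of_countable_subcover fun {ι} V hV hcov => ?_
  have fibre : ∀ x ∈ L, ∃ U ∈ 𝓝 x, ∃ t : Set ι, t.Countable ∧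
      (proj ⁻¹' U : Set (Resolution f)) ⊆ ⋃ i ∈ t, V i := by
    intro x hx
    have := hX.countableInterFilter_nhds x
    have hz : ∀ z : K x, ∃ i, ∃ U ∈ 𝓝 x, ∃ W ∈ 𝓝 z, box f x U W ⊆ V i := by
      intro z
      obtain ⟨i, hi⟩ := mem_iUnion.1 (hcov (show mk x z ∈ proj ⁻¹' L from hx))
      exact ⟨i, hV i x z hi⟩
    choose i U hU W hW h using hz
    obtain ⟨t, ht, -, htcov⟩ := (hK x).elim_nhds_subcover W fun z _ => hW z
    refine ⟨⋂ z ∈ t, U z, (countable_bInter_mem ht).2 fun z _ => hU z, i '' t, ht.image i, ?_⟩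
    intro p hp
    rw [biUnion_image]
    by_cases hpx : proj p = x
    · obtain ⟨w, rfl⟩ := eq_mk_of_proj_eq hpx
      obtain ⟨z, hz, hw⟩ := mem_iUnion₂.1 (htcov (mem_univ w))
      exact mem_iUnion₂.2 ⟨z, hz, h z (mk_mem_box.2 hw)⟩
    · obtain ⟨z, hz, hw⟩ := mem_iUnion₂.1 (htcov (mem_univ (f x (proj p))))
      exact mem_iUnion₂.2
        ⟨z, hz, h z ((mem_box_of_proj_ne hpx).2 ⟨mem_iInter₂.1 hp z hz, hw⟩)⟩
  choose! U hU t ht hcov' using fibre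
  obtain ⟨s, hs, hsL, hLs⟩ := hL.elim_nhds_subcover U hU
  refine ⟨⋃ x ∈ s, t x, hs.biUnion fun x hx => ht x (hsL x hx), fun p hp => ?_⟩
  obtain ⟨x, hx, hpx⟩ := mem_iUnion₂.1 (hLs hp)
  obtain ⟨i, hi, hpi⟩ := mem_iUnion₂.1 (hcov' x (hsL x hx) hpx)
  exact mem_iUnion₂.2 ⟨i, mem_iUnion₂.2 ⟨x, hx, hi⟩, hpi⟩

/-- The rank function of a resolution: the fibre over `x` occupies the ranks from `E x` on,
provided that these exceed the ranks occurring over the other points near `x`, and that ranks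
cofinal in `E x` occur in every neighbourhood of every point of the fibre. -/
theorem isRankFunction [T1Space X] (hf : ∀ x, ContinuousOn (f x) {x}ᶜ)
    {ρ : ∀ x, K x → Ordinal.{u}} (hρ : ∀ x, IsRankFunction (ρ x)) {E : X → Ordinal.{u}}
    (hlt : ∀ x, ∀ᶠ y in 𝓝[≠] x, ∀ t, E y + ρ y t < E x)
    (hcof : ∀ x, ∀ γ < E x, ∀ U ∈ 𝓝 x, ∀ W : Set (K x), IsOpen W → W.Nonempty →
      ∃ y ∈ U, y ≠ x ∧ f x y ∈ W ∧ ∃ t, γ ≤ E y + ρ y t) :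
    IsRankFunction fun p : Resolution f => E (proj p) + ρ (proj p) p.2 := by
  refine isRankFunction_iff.2 ?_
  rintro ⟨x, z⟩
  constructor
  · obtain ⟨⟨W, hW, hWlt⟩, -⟩ := isRankFunction_iff.1 (hρ x) z
    have hU := hlt x
    rw [eventually_nhdsWithin_iff, eventually_iff_exists_mem] at hU
    obtain ⟨U, hU, hUlt⟩ := hU
    refine ⟨box f x U W, box_mem_nhds hf hU hW, ?_⟩
    rintro p (⟨w, hw, rfl⟩ | ⟨h1, h2, -⟩) hp
    · exact add_lt_add_right (hWlt w hw fun h => hp (by rw [h]; rfl)) (E x)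
    · exact (hUlt _ h1 h2 p.2).trans_le le_self_add
  · intro γ hγ N hN
    obtain ⟨U, hU, W, hW, hN⟩ := exists_box_subset hN
    rcases lt_or_ge γ (E x) with hγE | hγE
    · obtain ⟨y, hyU, hyx, hyW, t, ht⟩ := hcof x γ hγE U hU (interior W) isOpen_interior
        ⟨z, mem_interior_iff_mem_nhds.2 hW⟩
      refine ⟨mk y t, hN (Or.inr ⟨hyU, hyx, interior_subset hyW⟩), fun h => hyx ?_, ht⟩
      exact congrArg proj h
    · obtain ⟨δ, rfl⟩ := exists_add_of_le hγE
      have hδ : δ < ρ x z := lt_of_add_lt_add_left hγ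
      obtain ⟨w, hw, hwz, hwδ⟩ := (isRankFunction_iff.1 (hρ x) z).2 δ hδ W hW
      exact ⟨mk x w, hN (mk_mem_box.2 hw), fun h => hwz (mk_injective x h),
        add_le_add_right hwδ (E x)⟩

end Resolution

/-! ### Maps given by admissible bases -/

open Cardinal in
theorem mk_countableOrdinals : #CountableOrdinals = ℵ₁ := by
  rw [CountableOrdinals, Cardinal.mk_Iio_ordinal, Ordinal.card_omega, lift_aleph]
  simp

theorem countable_Iio (ξ : CountableOrdinals) : (Iio ξ).Countable := by
  have h : (Iio ξ.1 : Set Ordinal.{0}).Countable := by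
    rw [← Cardinal.le_aleph0_iff_set_countable, Cardinal.mk_Iio_ordinal, Cardinal.lift_le_aleph0,
      ← Order.lt_succ_iff, Cardinal.succ_aleph0, ← Cardinal.lt_ord,
      Cardinal.ord_aleph]
    exact ξ.2
  exact (h.preimage Subtype.val_injective).mono fun ν hν => hν

open Cardinal in
/-- A nonempty set of at most `ℵ₁` points is the image of `ω₁` under a map all of whose fibres
are uncountable. -/
theorem exists_uncountable_fibres {S : Type u} [Nonempty S] (hS : #S ≤ ℵ₁) :
    ∃ π : CountableOrdinals → S, ∀ s, ¬ (π ⁻¹' {s}).Countable := by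
  obtain ⟨g, hg⟩ : ∃ g : CountableOrdinals → S, Function.Surjective g := by
    have h : Cardinal.lift.{1} #S ≤ Cardinal.lift.{u} #CountableOrdinals := by
      rw [mk_countableOrdinals, lift_aleph]
      simpa using Cardinal.lift_le.{1}.2 hS
    obtain ⟨i⟩ := Cardinal.lift_mk_le'.1 h
    exact ⟨Function.invFun i, Function.invFun_surjective i.injective⟩
  obtain ⟨e⟩ : Nonempty (CountableOrdinals ≃ CountableOrdinals × CountableOrdinals) := by
    rw [← Cardinal.eq, mk_prod, Cardinal.lift_id, mk_countableOrdinals]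
    exact (mul_eq_self (aleph0_le_aleph 1)).symm
  refine ⟨fun ν => g (e ν).1, fun s hs => ?_⟩
  obtain ⟨c, rfl⟩ := hg s
  have huniv : (univ : Set CountableOrdinals).Countable := by
    refine (hs.image fun ν => (e ν).2).mono fun ν _ => ?_
    exact ⟨e.symm (c, ν), by simp, by simp⟩
  rw [← le_aleph0_iff_set_countable, mk_univ, mk_countableOrdinals] at huniv
  exact aleph0_lt_aleph_one.not_ge huniv

/-- At a point `x` of rank `β + 1` with an admissible basis given by `U`, the space can be
resolved into any space `K` with a dense set of at most `ℵ₁` points: the map that is constant on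
each `U ν`, and takes each value in the dense set on uncountably many of them, takes values in any
given nonempty open set at points of rank `β` arbitrarily close to `x`. -/
theorem IsAdmissibleBasisBy.exists_map {X : Type u} [TopologicalSpace X] (hX : IsLLSP X)
    {β : Ordinal.{u}} {x : X} (hx : rank x = β + 1) {B : Set (Set X)}
    (hB : (𝓝 x).HasBasis (fun W => W ∈ B) id) {U : CountableOrdinals → Set X}
    (hU : IsAdmissibleBasisBy β x B U) {K : Type u} [TopologicalSpace K] [Nonempty K]
    {D : Set K} (hD : Dense D) (hDc : Cardinal.mk D ≤ Cardinal.aleph 1) :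
    ∃ f : X → K, ContinuousOn f {x}ᶜ ∧ ∀ V ∈ 𝓝 x, ∀ W : Set K, IsOpen W → W.Nonempty →
      ∃ y ∈ V, y ≠ x ∧ f y ∈ W ∧ rank y = β := by
  have := hX.hausdorff
  have : Nonempty D := hD.nonempty.to_subtype
  obtain ⟨π, hπ⟩ := exists_uncountable_fibres hDc
  have hxU : ∀ ν, x ∉ U ν := by
    intro ν hxν
    obtain ⟨y, hy, hyU⟩ := hU.cone ν
    rw [hX.scattered.level_eq] at hy
    have hy : rank y = β := hy
    have hxy : x = y := hyU.2.2.2 x hxν (by rw [hx, hy]; exact (Order.lt_add_one_iff.2 le_rfl).le)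
    rw [← hxy, hx] at hy
    exact (Order.lt_add_one_iff.2 le_rfl : β < β + 1).ne' hy
  classical
  let f : X → K := fun y => if h : ∃ ν, y ∈ U ν then (π h.choose).1 else Classical.arbitrary K
  have hfU : ∀ ν, ∀ y ∈ U ν, f y = π ν := by
    intro ν y hy
    have h : ∃ ν, y ∈ U ν := ⟨ν, hy⟩
    have hν : h.choose = ν := by
      by_contra hne
      exact Set.disjoint_left.1 (hU.disjoint hne) h.choose_spec hy
    simp only [f, dif_pos h, hν]
  have hUopen : ∀ ν, IsOpen (U ν) := fun ν => (hU.cone ν).choose_spec.2.2.1.isOpen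
  -- The union of the admissible neighbourhoods is Lindelöf, because every neighbourhood of `x`
  -- contains all but countably many of the Lindelöf sets `U ν`.
  have hT : IsLindelof ({x} ∪ ⋃ ν, U ν) := by
    refine isLindelof_of_countable_subcover fun {ι} V hV hcov => ?_
    obtain ⟨i, hi⟩ := mem_iUnion.1 (hcov (Or.inl rfl))
    obtain ⟨W, hW, hWV⟩ := hB.mem_iff.1 ((hV i).mem_nhds hi)
    rw [hU.eq] at hW
    obtain ⟨ξ, rfl⟩ := hW
    have hL : IsLindelof (⋃ ν ∈ Iio ξ, U ν) :=
      (countable_Iio ξ).isLindelof_biUnion fun ν _ => (hU.cone ν).choose_spec.2.1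
    obtain ⟨t, ht, hsub⟩ := hL.elim_countable_subcover V hV
      ((iUnion₂_subset fun ν _ => (subset_iUnion U ν).trans subset_union_right).trans hcov)
    refine ⟨insert i t, ht.insert i, ?_⟩
    rw [biUnion_insert]
    rintro y (rfl | hy)
    · exact Or.inl hi
    · obtain ⟨ν, hν⟩ := mem_iUnion.1 hy
      rcases lt_or_ge ν ξ with hlt | hge
      · exact Or.inr (hsub (mem_iUnion₂.2 ⟨ν, hlt, hν⟩))
      · exact Or.inl (hWV (Or.inr (mem_iUnion₂.2 ⟨ν, hge, hν⟩)))
  refine ⟨f, fun y hy => ContinuousAt.continuousWithinAt ?_, fun V hV W hW hWne => ?_⟩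
  · by_cases h : ∃ ν, y ∈ U ν
    · obtain ⟨ν, hν⟩ := h
      refine (continuousAt_const (y := (π ν).1)).congr ?_
      filter_upwards [(hUopen ν).mem_nhds hν] with z hz using (hfU ν z hz).symm
    · refine (continuousAt_const (y := Classical.arbitrary K)).congr ?_
      have hyT : y ∈ ({x} ∪ ⋃ ν, U ν)ᶜ := by
        rintro (hyx | hyU)
        · exact hy hyx
        · exact h (mem_iUnion.1 hyU)
      filter_upwards [(hX.pSpace.isClosed_of_isLindelof hT).isOpen_compl.mem_nhds hyT] with z hz
      have hz' : ¬ ∃ ν, z ∈ U ν := fun hz' => hz (Or.inr (mem_iUnion.2 hz'))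
      simp only [f, dif_neg hz']
  · obtain ⟨V', hV', hV'V⟩ := hB.mem_iff.1 hV
    rw [hU.eq] at hV'
    obtain ⟨ξ, rfl⟩ := hV'
    obtain ⟨d, hdW, hdD⟩ := hD.inter_open_nonempty W hW hWne
    obtain ⟨ν, hν, hξν⟩ : ∃ ν ∈ π ⁻¹' {⟨d, hdD⟩}, ξ ≤ ν := by
      by_contra! hne
      exact hπ ⟨d, hdD⟩ ((countable_Iio ξ).mono fun ν hν => hne ν hν)
    obtain ⟨y, hy, hyU⟩ := hU.cone ν
    have hyν : y ∈ U ν := mem_of_mem_nhds hyU.2.2.1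
    rw [hX.scattered.level_eq] at hy
    refine ⟨y, hV'V (Or.inr (mem_iUnion₂.2 ⟨ν, hξν, hyν⟩)), fun h => hxU ν (h ▸ hyν), ?_, hy⟩
    rw [hfU ν y hyν, show π ν = ⟨d, hdD⟩ from hν]
    exact hdW

/-! ### Stepping up -/

/-- The ordinals `startRank d r` at which consecutive closed intervals of ranks
`[startRank d r, startRank d r + d r]` begin. -/
noncomputable def startRank (d : Ordinal.{u} → Ordinal.{u}) (r : Ordinal.{u}) : Ordinal.{u} :=
  ⨆ s : Iio r, (startRank d s.1 + d s.1 + 1)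
termination_by r
decreasing_by exact s.2

theorem startRank_le_iff {d : Ordinal.{u} → Ordinal.{u}} {r γ : Ordinal.{u}} :
    startRank d r ≤ γ ↔ ∀ s < r, startRank d s + d s < γ := by
  rw [startRank, Ordinal.iSup_le_iff]
  simp

theorem startRank_add_lt {d : Ordinal.{u} → Ordinal.{u}} {r s : Ordinal.{u}} (h : s < r) :
    startRank d s + d s < startRank d r :=
  startRank_le_iff.1 le_rfl s h

theorem exists_le_of_lt_startRank {d : Ordinal.{u} → Ordinal.{u}} {r γ : Ordinal.{u}}
    (h : γ < startRank d r) : ∃ s < r, γ ≤ startRank d s + d s := by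
  by_contra! hne
  exact h.not_ge (startRank_le_iff.2 hne)

theorem startRank_add_mono {d : Ordinal.{u} → Ordinal.{u}} {r s : Ordinal.{u}} (h : s ≤ r) :
    startRank d s + d s ≤ startRank d r + d r := by
  rcases h.eq_or_lt with rfl | h
  · exact le_rfl
  · exact (startRank_add_lt h).le.trans le_self_add

/-- Good LLSP spaces of height `α` with levels of size at most `ℵ₁`. Unlike
`IsLLSPOf (Cardinal.aleph 1) α` together with `IsGood`, this is satisfied by the empty space,
for `α = 0`. -/
structure IsGoodThin (α : Ordinal.{u}) (Y : Type u) [TopologicalSpace Y] : Prop where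
  isLLSP : IsLLSP Y
  isGood : IsGood Y
  height_eq : height Y = α
  mk_level_le : ∀ β, Cardinal.mk (level Y β) ≤ Cardinal.aleph 1

theorem isGoodThin_pempty : IsGoodThin 0 PEmpty.{u + 1} := by
  have hr : IsRankFunction (X := PEmpty.{u + 1}) fun _ => 0 := fun x => x.elim
  have h0 : height PEmpty.{u + 1} = 0 := by
    rw [← nonpos_iff_eq_zero, hr.height_le_iff]
    exact fun x => x.elim
  refine ⟨⟨fun x => x.elim, hr.isScattered, ⟨fun x => x.elim⟩, fun S _ _ => ?_⟩, ?_, h0, ?_⟩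
  · rw [Set.eq_empty_of_isEmpty (⋂₀ S)]
    exact isOpen_empty
  · intro α hα
    rw [h0] at hα
    exact (not_lt_zero hα).elim
  · intro β
    rw [Set.eq_empty_of_isEmpty (level PEmpty.{u + 1} β)]
    simp

theorem IsLLSPOf.isGoodThin {X : Type u} [TopologicalSpace X] {α : Ordinal.{u}}
    (h : IsLLSPOf (Cardinal.aleph 1) α X) (hg : IsGood X) : IsGoodThin α X := by
  refine ⟨h.toIsLLSP, hg, h.height_eq, fun β => ?_⟩
  rcases lt_or_ge β (height X) with hβ | hβ
  · rw [← h.width_eq]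
    refine le_csSup ⟨Cardinal.mk X, ?_⟩ ⟨β, hβ, rfl⟩
    rintro _ ⟨γ, -, rfl⟩
    exact Cardinal.mk_set_le _
  · have : level X β = ∅ := by
      rw [h.scattered.level_eq, Set.eq_empty_iff_forall_notMem]
      rintro x rfl
      exact (h.scattered.rank_lt_height x).not_ge hβ
    rw [this]
    simp

namespace IsGoodThin

variable {Y : Type u} [TopologicalSpace Y] {α : Ordinal.{u}} (h : IsGoodThin α Y)
include h

theorem isLLSPOf (hα : α ≠ 0) : IsLLSPOf (Cardinal.aleph 1) α Y where
  toIsLLSP := h.isLLSP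
  height_eq := h.height_eq
  width_eq := by
    have key : ∀ β < height Y, Cardinal.mk (level Y β) = Cardinal.aleph 1 := by
      intro β hβ
      refine le_antisymm (h.mk_level_le β) ?_
      by_contra! hlt
      rw [← Cardinal.succ_aleph0, Order.lt_succ_iff, Cardinal.le_aleph0_iff_set_countable] at hlt
      exact h.isGood.not_countable_diff h.isLLSP hβ (L := fun _ => ∅)
        (fun _ => isLindelof_empty) (hlt.mono sdiff_subset)
    have : {c : Cardinal.{u} | ∃ β < height Y, c = Cardinal.mk (level Y β)}
        = {Cardinal.aleph 1} := by
      ext c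
      constructor
      · rintro ⟨β, hβ, rfl⟩
        exact key β hβ
      · rintro rfl
        have h0 : 0 < height Y := h.height_eq ▸ pos_iff_ne_zero.2 hα
        exact ⟨0, h0, (key 0 h0).symm⟩
    rw [width, this, csSup_singleton]

theorem below {β : Ordinal.{u}} (hβ : β ≤ α) : IsGoodThin β (Below Y β) := by
  have hβ' : β ≤ height Y := h.height_eq ▸ hβ
  refine ⟨h.isLLSP.below β, h.isGood.below h.isLLSP hβ',
    h.isLLSP.scattered.height_below hβ' (h.isGood.level_nonempty h.isLLSP), fun γ => ?_⟩
  rw [← Cardinal.mk_image_eq Subtype.val_injective]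
  refine (Cardinal.mk_le_mk_of_subset ?_).trans (h.mk_level_le γ)
  rw [(h.isLLSP.scattered.isRankFunction_below β).level_eq, h.isLLSP.scattered.level_eq]
  rintro _ ⟨y, hy, rfl⟩
  exact hy

theorem mk_rk_eq_le (γ : Ordinal.{u}) :
    Cardinal.mk {p : Lindelofication Y | Lindelofication.rk Y p = γ} ≤ Cardinal.aleph 1 := by
  have hsub : {p : Lindelofication Y | Lindelofication.rk Y p = γ} ⊆
      insert Lindelofication.infty (Lindelofication.of '' level Y γ) := by
    intro p hp
    rcases Lindelofication.eq_infty_or p with rfl | ⟨z, rfl⟩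
    · exact Or.inl rfl
    · refine Or.inr (mem_image_of_mem _ ?_)
      rw [h.isLLSP.scattered.level_eq]
      exact hp
  refine (Cardinal.mk_le_mk_of_subset hsub).trans (Cardinal.mk_insert_le.trans ?_)
  refine Cardinal.add_le_of_le (Cardinal.aleph0_le_aleph 1)
    (Cardinal.mk_image_le.trans (h.mk_level_le γ)) ?_
  exact Cardinal.one_le_aleph0.trans (Cardinal.aleph0_le_aleph 1)

end IsGoodThin

/-- Resolving every point of rank `r` of `X` into the Lindelöfication of a good space of height
`d r` gives a good space, if the resolving maps take values in any given nonempty open set at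
points near `x` of rank cofinal in the rank of `x`. -/
theorem IsGoodThin.resolution {X : Type u} [TopologicalSpace X] {δ : Ordinal.{u}}
    (hX : IsGoodThin δ X) {d : Ordinal.{u} → Ordinal.{u}} {Z : Ordinal.{u} → Type u}
    [∀ r, TopologicalSpace (Z r)] (hZ : ∀ r, IsGoodThin (d r) (Z r))
    (f : ∀ x : X, X → Lindelofication (Z (rank x))) (hf : ∀ x, ContinuousOn (f x) {x}ᶜ)
    (hcof : ∀ x, ∀ s < rank x, ∀ U ∈ 𝓝 x, ∀ W : Set (Lindelofication (Z (rank x))),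
      IsOpen W → W.Nonempty → ∃ y ∈ U, y ≠ x ∧ f x y ∈ W ∧ s ≤ rank y) :
    ∃ α : Ordinal.{u}, (∀ r < δ, d r < α) ∧ IsGoodThin α (Resolution f) := by
  have := hX.isLLSP.hausdorff
  have hK : ∀ r, ∀ t : Lindelofication (Z r), Lindelofication.rk (Z r) t ≤ d r := fun r t =>
    (hZ r).height_eq ▸ Lindelofication.rk_le_height (hZ r).isLLSP t
  have : ∀ r, T2Space (Lindelofication (Z r)) := fun r => Lindelofication.t2Space (hZ r).isLLSP
  let ρ : Resolution f → Ordinal.{u} := fun p =>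
    startRank d (rank (Resolution.proj p)) + Lindelofication.rk (Z (rank p.1)) p.2
  have hρ : IsRankFunction ρ := by
    refine Resolution.isRankFunction hf (E := fun x => startRank d (rank x))
      (ρ := fun x => Lindelofication.rk (Z (rank x)))
      (fun x => Lindelofication.isRankFunction_rk (hZ _).isLLSP (hZ _).isGood) ?_ ?_
    · intro x
      filter_upwards [(hX.isLLSP.scattered.isRankFunction_rank x).1] with y hy t
      exact (add_le_add_right (hK _ t) _).trans_lt (startRank_add_lt hy)
    · intro x γ hγ U hU W hW hWne
      obtain ⟨s, hs, hγs⟩ := exists_le_of_lt_startRank hγ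
      obtain ⟨y, hyU, hyx, hyW, hsy⟩ := hcof x s hs U hU W hW hWne
      refine ⟨y, hyU, hyx, hyW, Lindelofication.infty, ?_⟩
      rw [Lindelofication.rk_infty, (hZ _).height_eq]
      exact hγs.trans (startRank_add_mono hsy)
  have hle : ∀ p : Resolution f, ρ p ≤ startRank d (rank (Resolution.proj p)) +
      d (rank (Resolution.proj p)) := fun p => add_le_add_right (hK _ p.2) _
  refine ⟨height (Resolution f), ?_, ⟨?_, hρ.isScattered, ?_, ?_⟩, ?_, rfl, ?_⟩
  · intro r hr
    obtain ⟨x, hx⟩ := hX.isGood.level_nonempty hX.isLLSP r (hX.height_eq ▸ hr)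
    rw [hX.isLLSP.scattered.level_eq] at hx
    obtain rfl : rank x = r := hx
    refine lt_of_le_of_lt ?_ ((hρ.height_le_iff _).1 le_rfl
      (Resolution.mk x Lindelofication.infty))
    have : ρ (Resolution.mk x Lindelofication.infty) = startRank d (rank x) + d (rank x) :=
      congrArg (_ + ·) (hZ (rank x)).height_eq
    rw [this]
    exact le_add_self
  · intro p
    obtain ⟨L, hL, hLL⟩ := hX.isLLSP.locallyLindelof (Resolution.proj p)
    exact ⟨_, Resolution.continuous_proj.continuousAt hL, Resolution.isLindelof_preimage_proj
      hX.isLLSP.pSpace (fun x => Lindelofication.isLindelof_univ) hLL⟩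
  · exact Resolution.t2Space hf
  · exact Resolution.isPSpace hf hX.isLLSP.pSpace
      fun x => Lindelofication.isPSpace (hZ _).isLLSP.pSpace
  · intro γ hγ V hV hcount
    obtain ⟨p, hp⟩ : ∃ p, γ ≤ ρ p := by
      by_contra! hne
      exact hγ.not_ge ((hρ.height_le_iff _).2 hne)
    -- The points of rank `γ` lie over the points of rank `r` of `X`.
    obtain ⟨r, hr, hmin⟩ := exists_minimal_le_of_wellFoundedLT
      (fun r => γ ≤ startRank d r + d r) _ (hp.trans (hle p))
    have hrγ : startRank d r ≤ γ := startRank_le_iff.2 fun s hs => by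
      by_contra! hγs
      exact hs.not_ge (hmin.2 hγs hs.le)
    obtain ⟨ε, rfl⟩ := exists_add_of_le hrγ
    have hε : ε ≤ height (Z r) := by
      rw [(hZ r).height_eq]
      exact le_of_add_le_add_left hmin.1
    refine hX.isGood.not_countable_diff hX.isLLSP
      (hr.trans_lt (hX.isLLSP.scattered.rank_lt_height _))
      (L := fun n => Resolution.proj '' V n) (fun n => ?_)
      ((hcount.image Resolution.proj).mono ?_)
    · obtain ⟨q, hq⟩ := hV n
      exact hq.1.image Resolution.continuous_proj
    · rintro x ⟨hx, hxV⟩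
      rw [hX.isLLSP.scattered.level_eq] at hx
      obtain rfl : rank x = r := hx
      obtain ⟨t, ht⟩ := Lindelofication.exists_rk_eq (hZ _).isLLSP (hZ _).isGood hε
      refine ⟨Resolution.mk x t, ⟨?_, fun hmem => hxV ?_⟩, rfl⟩
      · rw [hρ.level_eq]
        exact congrArg (startRank d (rank x) + ·) ht
      · obtain ⟨n, hn⟩ := mem_iUnion.1 hmem
        exact mem_iUnion.2 ⟨n, mem_image_of_mem _ hn⟩
  · intro γ
    rw [hρ.level_eq]
    rcases Set.eq_empty_or_nonempty {p | ρ p = γ} with hemp | ⟨p, hp⟩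
    · rw [hemp]
      simp
    have hp : ρ p = γ := hp
    obtain ⟨ε, hε⟩ := exists_add_of_le
      (show startRank d (rank (Resolution.proj p)) ≤ γ from hp ▸ le_self_add)
    have hrank : ∀ q, ρ q = γ → rank (Resolution.proj q) = rank (Resolution.proj p) := by
      have aux : ∀ q q', ρ q = ρ q' →
          ¬ rank (Resolution.proj q) < rank (Resolution.proj q') := fun q q' hqq' hlt =>
        (((hle q).trans_lt (startRank_add_lt hlt)).trans_le le_self_add).ne hqq'
      intro q hq
      exact le_antisymm (not_lt.1 (aux p q (hp.trans hq.symm)))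
        (not_lt.1 (aux q p (hq.trans hp.symm)))
    have hsub : {q | ρ q = γ} ⊆ ⋃ x ∈ level X (rank (Resolution.proj p)),
        Resolution.mk x '' {t | Lindelofication.rk (Z (rank x)) t = ε} := by
      rintro ⟨x, t⟩ hq
      have hx : rank x = rank (Resolution.proj p) := hrank ⟨x, t⟩ hq
      refine mem_iUnion₂.2 ⟨x, ?_, mem_image_of_mem _ ?_⟩
      · rw [hX.isLLSP.scattered.level_eq]
        exact hx
      · have hq : startRank d (rank x) + Lindelofication.rk (Z (rank x)) t = γ := hq
        rw [hε, ← hx] at hq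
        exact add_left_cancel hq
    refine (Cardinal.mk_le_mk_of_subset hsub).trans ((Cardinal.mk_biUnion_le _ _).trans ?_)
    refine (mul_le_mul' (hX.mk_level_le _) (ciSup_le' fun x => ?_)).trans
      (Cardinal.mul_eq_self (Cardinal.aleph0_le_aleph 1)).le
    exact Cardinal.mk_image_le.trans ((hZ _).mk_rk_eq_le ε)

/-- In an admissible space of limit height the points of successor rank can be resolved into
arbitrary good spaces. -/
theorem IsGoodThin.exists_resolution {X : Type u} [TopologicalSpace X] {δ : Ordinal.{u}}
    (hX : IsGoodThin δ X) (hadm : IsAdmissible X) (hδ : Order.IsSuccLimit δ)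
    {F : Ordinal.{u} → Ordinal.{u}}
    (hF : ∀ r, ∃ (Z : Type u) (_ : TopologicalSpace Z), IsGoodThin (F r) Z) :
    ∃ (α : Ordinal.{u}) (Y : Type u) (_ : TopologicalSpace Y),
      (∀ r < δ, F r < α) ∧ IsGoodThin α Y := by
  -- Points of rank `β + 1` are resolved into spaces of height `F β`, all others into points.
  have hd : ∀ r : Ordinal.{u}, ∃ (d : Ordinal.{u}) (Z : Type u) (_ : TopologicalSpace Z),
      IsGoodThin d Z ∧ (∀ β, r = β + 1 → d = F β) ∧ ((∀ β, r ≠ β + 1) → d = 0) := by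
    intro r
    by_cases h : ∃ β, r = β + 1
    · obtain ⟨β, rfl⟩ := h
      obtain ⟨Z, hZt, hZ⟩ := hF β
      exact ⟨F β, Z, hZt, hZ, fun γ hγ => by rw [Order.add_one_inj.1 hγ],
        fun h => (h β rfl).elim⟩
    · push Not at h
      exact ⟨0, PEmpty, inferInstance, isGoodThin_pempty, fun β hβ => (h β hβ).elim,
        fun _ => rfl⟩
  choose d Z hZt hZ hdsucc hdlim using hd
  obtain ⟨B, hB, hBadm⟩ := hadm
  have hmap : ∀ x : X, ∃ f : X → Lindelofication (Z (rank x)), ContinuousOn f {x}ᶜ ∧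
      ∀ s < rank x, ∀ U ∈ 𝓝 x, ∀ W : Set (Lindelofication (Z (rank x))),
      IsOpen W → W.Nonempty → ∃ y ∈ U, y ≠ x ∧ f y ∈ W ∧ s ≤ rank y := by
    intro x
    have : Nonempty (Lindelofication (Z (rank x))) := ⟨Lindelofication.infty⟩
    by_cases h : ∃ β, rank x = β + 1
    · obtain ⟨β, hβ⟩ := h
      have hβδ : β + 1 < height X := hβ ▸ hX.isLLSP.scattered.rank_lt_height x
      obtain ⟨U, hU⟩ := (hBadm β hβδ).1 x (by rw [hX.isLLSP.scattered.level_eq]; exact hβ)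
      have hrk := Lindelofication.isRankFunction_rk (hZ (rank x)).isLLSP (hZ (rank x)).isGood
      have hdense : Dense {p | Lindelofication.rk (Z (rank x)) p = 0} := by
        refine dense_iff_inter_open.2 fun W hW hne => ?_
        obtain ⟨p, hp, hp0⟩ := hrk.exists_eq_zero_mem hW hne
        exact ⟨p, hp, hp0⟩
      obtain ⟨f, hf, hfW⟩ := hU.exists_map hX.isLLSP hβ (hB x) hdense
        ((hZ (rank x)).mk_rk_eq_le 0)
      refine ⟨f, hf, fun s hs V hV W hW hne => ?_⟩
      obtain ⟨y, hyV, hyx, hyW, hy⟩ := hfW V hV W hW hne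
      exact ⟨y, hyV, hyx, hyW, hy ▸ Order.lt_add_one_iff.1 (hβ ▸ hs)⟩
    · push Not at h
      have h0 : height (Z (rank x)) = 0 := (hZ _).height_eq.trans (hdlim _ h)
      refine ⟨fun _ => Lindelofication.infty, continuousOn_const,
        fun s hs U hU W hW hne => ?_⟩
      obtain ⟨y, hyU, hyx, hsy⟩ :=
        (isRankFunction_iff.1 hX.isLLSP.scattered.isRankFunction_rank x).2 s hs U hU
      refine ⟨y, hyU, hyx, ?_, hsy⟩
      obtain ⟨p, hp⟩ := hne
      rcases Lindelofication.eq_infty_or p with rfl | ⟨z, rfl⟩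
      · exact hp
      · exact (not_lt_zero (h0 ▸ (hZ _).isLLSP.scattered.rank_lt_height z)).elim
  choose f hf hfcof using hmap
  obtain ⟨α, hα, hY⟩ := hX.resolution hZ f hf hfcof
  refine ⟨α, Resolution f, inferInstance, fun r hr => ?_, hY⟩
  have := hα (r + 1) (hδ.add_one_lt hr)
  rwa [hdsucc (r + 1) r rfl] at this

/-- An ordinal `0 < α < λ⁺` is enumerated, with repetitions, in type `λ`. -/
theorem exists_enumeration {lam : Cardinal.{u}} {α : Ordinal.{u}} (hα0 : α ≠ 0)
    (hα : α < (Order.succ lam).ord) : ∃ F : Ordinal.{u} → Ordinal.{u},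
      (∀ r, F r < α) ∧ ∀ γ < α, ∃ r < lam.ord, F r = γ := by
  have hcard : Cardinal.mk (Iio α) ≤ Cardinal.mk (Iio lam.ord) := by
    rw [Cardinal.mk_Iio_ordinal, Cardinal.mk_Iio_ordinal, Cardinal.lift_le, Cardinal.card_ord]
    exact Order.lt_succ_iff.1 (Cardinal.lt_ord.1 hα)
  obtain ⟨i⟩ := hcard
  have : Nonempty (Iio α) := ⟨⟨0, pos_iff_ne_zero.2 hα0⟩⟩
  have hinj : Function.Injective fun γ => (i γ).1 := Subtype.val_injective.comp i.injective
  refine ⟨fun r => (Function.invFun (fun γ => (i γ).1) r).1, fun r => Subtype.prop _,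
    fun γ hγ => ⟨i ⟨γ, hγ⟩, (i ⟨γ, hγ⟩).2, ?_⟩⟩
  exact congrArg Subtype.val (Function.leftInverse_invFun hinj ⟨γ, hγ⟩)

/-- By induction on `α`, the intermediate heights being smaller than `α`: the resolution of `X` by
spaces whose heights enumerate the ordinals below `α` has height at least `α`, and its points of
rank below `α` form the required space. -/
theorem IsGoodThin.exists_of_lt {lam : Cardinal.{u}} (hlam : Cardinal.aleph0 ≤ lam) {X : Type u}
    [TopologicalSpace X] (hX : IsGoodThin lam.ord X) (hadm : IsAdmissible X) (α : Ordinal.{u})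
    (hα : α < (Order.succ lam).ord) :
    ∃ (Y : Type u) (_ : TopologicalSpace Y), IsGoodThin α Y := by
  induction α using WellFoundedLT.induction with
  | ind α ih =>
    rcases eq_or_ne α 0 with rfl | hα0
    · exact ⟨PEmpty, inferInstance, isGoodThin_pempty⟩
    obtain ⟨F, hFα, hF⟩ := exists_enumeration hα0 hα
    obtain ⟨α', Y, hYt, hα', hY⟩ := hX.exists_resolution hadm (Cardinal.isSuccLimit_ord hlam)
      fun r => ih (F r) (hFα r) ((hFα r).trans hα)
    refine ⟨Below Y α, inferInstance, hY.below (le_of_forall_lt fun γ hγ => ?_)⟩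
    obtain ⟨r, hr, rfl⟩ := hF γ hγ
    exact hα' r hr

end LLSP

theorem theorem3p3 (lam : Cardinal.{u}) (hlam : Cardinal.aleph 2 ≤ lam)
    (h : ∃ (X : Type u) (_ : TopologicalSpace X),
      LLSP.IsLLSPOf (Cardinal.aleph 1) lam.ord X ∧ LLSP.IsGood X ∧ LLSP.IsAdmissible X)
    (α : Ordinal.{u}) (hα0 : α ≠ 0) (hα : α < (Order.succ lam).ord) :
    ∃ (Y : Type u) (_ : TopologicalSpace Y),
      LLSP.IsLLSPOf (Cardinal.aleph 1) α Y ∧ LLSP.IsGood Y := by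
  obtain ⟨X, _, hX, hg, hadm⟩ := h
  obtain ⟨Y, hYt, hY⟩ := (hX.isGoodThin hg).exists_of_lt
    ((Cardinal.aleph0_le_aleph 2).trans hlam) hadm α hα
  exact ⟨Y, hYt, hY.isLLSPOf hα0, hY.isGood⟩
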